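/- Let $d\ge 1$, $|x|=\sum_{i=1}^d|x_i|$ for $x\in\mathbb R^d$, $\mathcal C=\{x\in\mathbb R^d: x_i\ge 0\ \forall i\}$, $\mathbb X=\{x\in\mathcal C:|x|=1\}$. Let $S$ be the set of $d\times d$ matrices with non-negative entries each of whose columns has a positive entry, and $\mathring S$ the set of matrices with positive entries. For $g\in S$ put $v(g)=\min_j\sum_i g(i,j)$, $|g|=\max_j\sum_i g(i,j)$, $N(g)=\max(1/v(g),|g|)$, and for $x\in\mathbb X$ put $g\cdot x=gx/|gx|$, $\rho(g,x)=\log|gx|$. Let $\mu$ be a probability measure on $S$ and let $\mu^{*n}$ be the law of a product of $n$ independent matrices of law $\mu$. Assume: - P1: there is $\delta_0>0$ with $\int_S N(g)^{\delta_0}\,\mu(dg)<\infty$. - P2: there is no affine subspace $A$ of $\mathbb R^d$ such that $A\cap\mathcal C$ contains a non-zero vector, is bounded, and is invariant under $x\mapsto gx$ for all $g$ in the support of $\mu$. - P3: there is $n_0\ge1$ with $\mu^{*n_0}(\mathring S)>0$. - P4: the upper Lyapunov exponent $\gamma_\mu=\lim_{n\to\infty}\frac1n\int_S\log|g|\,\mu^{*n}(dg)$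 is equal to $0$. - P5: there is $\delta>0$ with $\mu\{g\in S:\forall x\in\mathbb X,\ \log|gx|\ge\delta\}>0$. Let $(g_n)_{n\ge0}$ be i.i.d. random matrices of law $\mu$ on a probability space. For $x\in\mathbb X$ let $X_0=x$, $X_n=(g_n\cdots g_1)\cdot x$, $a_k=\rho(g_k,X_{k-1})$ for $k\ge1$, and $a_0=0$. For $k_{gap},M_1,M_2\in\mathbb N$ and natural numbers $j_0<\dots<j_{M_1+M_2}$, let $J_m=[j_{m-1},j_m)\cap\mathbb N$ and $a_{k+J_m}=\sum_{l\in J_m}a_{k+l}$, and let $\bar a_1=(a_{J_1},\dots,a_{J_{M_1}})$, $\bar a_2=(a_{k_{gap}+J_{M_1+1}},\dots,a_{k_{gap}+J_{M_1+M_2}})$. For $s\in\mathbb R^{M_1}$, $t\in\mathbb R^{M_2}$ let $$\phi(s,t)=\mathbb E\,e^{i s\cdot\bar a_1+i t\cdot\bar a_2},\qquad \phi_1(s)=\mathbb E\,e^{i s\cdot\bar a_1},\qquad \phi_2(t)=\mathbb E\,e^{i t\cdot\bar a_2}.$$ Proposition 5.1 (C1). There exist positive constants $\varepsilon_0\le1,\lambda_0,\lambda_1,\lambda_2$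 such that for all $x\in\mathbb X$, all $k_{gap},M_1,M_2\in\mathbb N$, all natural numbers $j_0<\dots<j_{M_1+M_2}$ and all $s\in\mathbb R^{M_1}$, $t\in\mathbb R^{M_2}$ with $|(s,t)|_\infty\le\varepsilon_0$, $$|\phi(s,t)-\phi_1(s)\phi_2(t)|\le\lambda_0e^{-\lambda_1k_{gap}}\Bigl(1+\max_{m=1,\dots,M_1+M_2}\operatorname{card}J_m\Bigr)^{\lambda_2(M_1+M_2)}$$ (the maximum is $0$ if $M_1+M_2=0$). -/

import Mathlib

open MeasureTheory ProbabilityTheory Filter Topology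
open scoped Matrix

namespace PosMatrix

/-- Real `d × d` matrices. -/
abbrev Mat (d : ℕ) : Type := Matrix (Fin d) (Fin d) ℝ

/-- The (entrywise, i.e. Borel) σ-algebra on matrices. -/
instance instMeasurableSpaceMat (d : ℕ) : MeasurableSpace (Matrix (Fin d) (Fin d) ℝ) :=
  inferInstanceAs (MeasurableSpace (Fin d → Fin d → ℝ))

instance instBorelSpaceMat (d : ℕ) : BorelSpace (Matrix (Fin d) (Fin d) ℝ) :=
  inferInstanceAs (BorelSpace (Fin d → Fin d → ℝ))

/-- The norm `|x| = ∑ |xᵢ|` on `ℝ^d`. -/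
noncomputable def l1 {d : ℕ} (x : Fin d → ℝ) : ℝ := ∑ i, |x i|

/-- The cone of vectors with non-negative coordinates. -/
def cone (d : ℕ) : Set (Fin d → ℝ) := {x | ∀ i, 0 ≤ x i}

/-- The limited cone `𝕏` of non-negative vectors of norm one. -/
def simplex (d : ℕ) : Set (Fin d → ℝ) := {x | x ∈ cone d ∧ l1 x = 1}

/-- The semigroup `S` of non-negative matrices all of whose columns have a positive entry. -/
def semigroupS (d : ℕ) : Set (Mat d) := {g | (∀ i j, 0 ≤ g i j) ∧ ∀ j, ∃ i, 0 < g i j}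

/-- The interior of `S`: matrices with positive entries. -/
def interiorS (d : ℕ) : Set (Mat d) := {g | ∀ i j, 0 < g i j}

/-- `v(g)`, the smallest column sum. -/
noncomputable def minCol {d : ℕ} (g : Mat d) : ℝ := ⨅ j, ∑ i, g i j

/-- `|g|`, the largest column sum. -/
noncomputable def maxCol {d : ℕ} (g : Mat d) : ℝ := ⨆ j, ∑ i, g i j

/-- `N(g) = max (1 / v(g), |g|)`. -/
noncomputable def sizeN {d : ℕ} (g : Mat d) : ℝ := max (1 / minCol g) (maxCol g)

/-- The projective action `g · x = g x / |g x|`. -/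
noncomputable def projAct {d : ℕ} (g : Mat d) (x : Fin d → ℝ) : Fin d → ℝ :=
  (l1 (g *ᵥ x))⁻¹ • (g *ᵥ x)

/-- The cocycle `ρ(g, x) = log |g x|`. -/
noncomputable def rho {d : ℕ} (g : Mat d) (x : Fin d → ℝ) : ℝ := Real.log (l1 (g *ᵥ x))

/-- `μ^{*n}`, the law of a product of `n` independent matrices of law `μ`. -/
noncomputable def convPow {d : ℕ} (μ : Measure (Mat d)) : ℕ → Measure (Mat d)
  | 0 => Measure.dirac 1
  | n + 1 => Measure.mconv μ (convPow μ n)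

/-- P1: a moment of positive order of `N`. -/
def P1 {d : ℕ} (μ : Measure (Mat d)) : Prop :=
  ∃ δ₀ : ℝ, 0 < δ₀ ∧ Integrable (fun g => sizeN g ^ δ₀) μ

/-- P2: no affine subspace `A` of `ℝ^d` is such that `A ∩ cone` is non-empty, bounded and invariant
under the linear action of all elements of the support of `μ` (relative to `S`).  The vertex `0`
of the cone, which every matrix fixes, does not count: otherwise `A = {0}` would always be such
a subspace. -/
def P2 {d : ℕ} (μ : Measure (Mat d)) : Prop :=
  ¬ ∃ A : AffineSubspace ℝ (Fin d → ℝ),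
    (∃ x ∈ (A : Set (Fin d → ℝ)) ∩ cone d, x ≠ 0) ∧
    Bornology.IsBounded ((A : Set (Fin d → ℝ)) ∩ cone d) ∧
    ∀ g ∈ μ.support ∩ semigroupS d, ∀ x ∈ (A : Set (Fin d → ℝ)) ∩ cone d,
      g *ᵥ x ∈ (A : Set (Fin d → ℝ)) ∩ cone d

/-- P3: some convolution power charges the matrices with positive entries. -/
def P3 {d : ℕ} (μ : Measure (Mat d)) : Prop :=
  ∃ n₀ : ℕ, 1 ≤ n₀ ∧ 0 < convPow μ n₀ (interiorS d)

/-- `γ` is the upper Lyapunov exponent of `μ`: the limit of `𝔼[log |gₙ ⋯ g₁|] / n`. -/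
def IsUpperLyapunov {d : ℕ} (μ : Measure (Mat d)) (γ : ℝ) : Prop :=
  Tendsto (fun n : ℕ => (∫ g, Real.log (maxCol g) ∂(convPow μ n)) / n) atTop (𝓝 γ)

/-- P4: the upper Lyapunov exponent vanishes. -/
def P4 {d : ℕ} (μ : Measure (Mat d)) : Prop := IsUpperLyapunov μ 0

/-- P5: with positive probability all vectors are expanded by a fixed factor. -/
def P5 {d : ℕ} (μ : Measure (Mat d)) : Prop :=
  ∃ δ : ℝ, 0 < δ ∧ 0 < μ {g | g ∈ semigroupS d ∧ ∀ x ∈ simplex d, δ ≤ rho g x}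

section Chain

variable {Ω : Type*} {d : ℕ}

/-- The left products `L₀ = 1`, `Lₙ = gₙ ⋯ g₁`. -/
def leftProd (g : ℕ → Ω → Mat d) : ℕ → Ω → Mat d
  | 0, _ => 1
  | n + 1, ω => g (n + 1) ω * leftProd g n ω

/-- The Markov chain `Xₙ = Lₙ · x` started at `x`. -/
noncomputable def chain (g : ℕ → Ω → Mat d) (x : Fin d → ℝ) (n : ℕ) (ω : Ω) : Fin d → ℝ :=
  projAct (leftProd g n ω) x

/-- The increments `aₖ = ρ(gₖ, Xₖ₋₁)`, `k ≥ 1`; the convention `g₀ = 1`, `X₋₁ = X₀` gives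
`a₀ = log |x| = 0`. -/
noncomputable def incr (g : ℕ → Ω → Mat d) (x : Fin d → ℝ) : ℕ → Ω → ℝ
  | 0, _ => 0
  | k + 1, ω => rho (g (k + 1) ω) (chain g x k ω)

/-- The blocks of indices `J₁, J₂, …`, numbered from zero: `block j m = J_{m+1} = [j_m, j_{m+1})`. -/
def block (j : ℕ → ℕ) (m : ℕ) : Finset ℕ := Finset.Ico (j m) (j (m + 1))

/-- The block sum `a_{k + J} = ∑_{l ∈ J} a_{k + l}`. -/
noncomputable def blockSum (g : ℕ → Ω → Mat d) (x : Fin d → ℝ) (k : ℕ) (J : Finset ℕ) (ω : Ω) : ℝ :=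
  ∑ l ∈ J, incr g x (k + l) ω

/-- The scalar product of `s` with the vector of the first `M₁` block sums. -/
noncomputable def dotA1 (g : ℕ → Ω → Mat d) (x : Fin d → ℝ) (j : ℕ → ℕ) {M₁ : ℕ}
    (s : Fin M₁ → ℝ) (ω : Ω) : ℝ :=
  ∑ m : Fin M₁, s m * blockSum g x 0 (block j m) ω

/-- The scalar product of `t` with the vector of the last `M₂` block sums, shifted by `k`. -/
noncomputable def dotA2 (g : ℕ → Ω → Mat d) (x : Fin d → ℝ) (j : ℕ → ℕ) (k M₁ : ℕ) {M₂ : ℕ}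
    (t : Fin M₂ → ℝ) (ω : Ω) : ℝ :=
  ∑ m : Fin M₂, t m * blockSum g x k (block j (M₁ + m)) ω

variable [MeasurableSpace Ω]

/-- The characteristic function of the first vector of block sums. -/
noncomputable def phi1 (P : Measure Ω) (g : ℕ → Ω → Mat d) (x : Fin d → ℝ) (j : ℕ → ℕ) {M₁ : ℕ}
    (s : Fin M₁ → ℝ) : ℂ :=
  ∫ ω, Complex.exp (Complex.I * (dotA1 g x j s ω : ℂ)) ∂P

/-- The characteristic function of the second vector of block sums. -/
noncomputable def phi2 (P : Measure Ω) (g : ℕ → Ω → Mat d) (x : Fin d → ℝ) (j : ℕ → ℕ) (k M₁ : ℕ)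
    {M₂ : ℕ} (t : Fin M₂ → ℝ) : ℂ :=
  ∫ ω, Complex.exp (Complex.I * (dotA2 g x j k M₁ t ω : ℂ)) ∂P

/-- The joint characteristic function of the two vectors of block sums. -/
noncomputable def phi (P : Measure Ω) (g : ℕ → Ω → Mat d) (x : Fin d → ℝ) (j : ℕ → ℕ) (k : ℕ)
    {M₁ M₂ : ℕ} (s : Fin M₁ → ℝ) (t : Fin M₂ → ℝ) : ℂ :=
  ∫ ω, Complex.exp (Complex.I * ((dotA1 g x j s ω : ℂ) + (dotA2 g x j k M₁ t ω : ℂ))) ∂P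

end Chain

/-- The largest cardinality of the first `M` blocks. -/
def maxCard (j : ℕ → ℕ) (M : ℕ) : ℕ := (Finset.range M).sup fun m => (block j m).card

end PosMatrix

/-! A positive matrix contracts projective distances on the cone, so the chain forgets its starting
point exponentially fast. Let p = j_{M₁}, and restart the chain at time p from the deterministic
point x, driven by the same later matrices. The restarted increments depend only on g_i with i > p,
while the first vector of block sums depends only on g_i with i ≤ p, so the two are independent. The
covariance to be bounded is therefore at most twice the mean distance between the second exponential
and its restarted copy (`norm_integral_mul_sub_le`).

That distance is a sum over times of E min(2, |a − a'|), where a' is the restarted increment.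
Truncation at 2 is free because exponentials of imaginary numbers have modulus one, and it removes
any need for moments of the increments. Each term decays geometrically in the time since the restart
(`exists_integral_min_two_abs_incr_sub_le`). By P3, products of n₀ matrices have, with positive
probability, entries comparable within each row. Such a product shrinks projective closeness by 1 −
κ² (`ProjClose.projAct_of_rowComparable`), every other one does not increase it, and disjoint blocks
of n₀ matrices are independent. Summing the geometric series from the gap onward gives a bound of
order r^k, uniform in the blocks. -/

namespace PosMatrix

/-! ### Projective contraction on the cone -/

section Cone

variable {d : ℕ}

lemma l1_of_mem_cone {x : Fin d → ℝ} (hx : x ∈ cone d) : l1 x = ∑ i, x i :=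
  Finset.sum_congr rfl fun i _ => abs_of_nonneg (hx i)

lemma l1_smul (c : ℝ) (x : Fin d → ℝ) : l1 (c • x) = |c| * l1 x := by
  simp [l1, abs_mul, Finset.mul_sum]

lemma l1_mono {x y : Fin d → ℝ} (hx : x ∈ cone d) (hxy : ∀ i, x i ≤ y i) : l1 x ≤ l1 y := by
  rw [l1_of_mem_cone hx, l1_of_mem_cone fun i => (hx i).trans (hxy i)]
  exact Finset.sum_le_sum fun i _ => hxy i

lemma smul_mem_cone {c : ℝ} (hc : 0 ≤ c) {x : Fin d → ℝ} (hx : x ∈ cone d) : c • x ∈ cone d :=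
  fun i => mul_nonneg hc (hx i)

lemma one_mem_semigroupS : (1 : Mat d) ∈ semigroupS d :=
  ⟨fun i j => by by_cases h : i = j <;> simp [Matrix.one_apply, h], fun j => ⟨j, by simp⟩⟩

lemma mul_mem_semigroupS {g h : Mat d} (hg : g ∈ semigroupS d) (hh : h ∈ semigroupS d) :
    g * h ∈ semigroupS d := by
  refine ⟨fun i j => ?_, fun j => ?_⟩
  · rw [Matrix.mul_apply]
    exact Finset.sum_nonneg fun k _ => mul_nonneg (hg.1 _ _) (hh.1 _ _)
  · obtain ⟨k, hk⟩ := hh.2 j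
    obtain ⟨i, hi⟩ := hg.2 k
    refine ⟨i, ?_⟩
    rw [Matrix.mul_apply]
    exact Finset.sum_pos' (fun k _ => mul_nonneg (hg.1 _ _) (hh.1 _ _))
      ⟨k, Finset.mem_univ _, mul_pos hi hk⟩

lemma mulVec_mem_cone {g : Mat d} (hg : g ∈ semigroupS d) {x : Fin d → ℝ} (hx : x ∈ cone d) :
    g *ᵥ x ∈ cone d :=
  fun i => by
    rw [Matrix.mulVec, dotProduct]
    exact Finset.sum_nonneg fun k _ => mul_nonneg (hg.1 i k) (hx k)

lemma mulVec_mono {g : Mat d} (hg : g ∈ semigroupS d) {x y : Fin d → ℝ}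
    (h : ∀ i, x i ≤ y i) (i : Fin d) : (g *ᵥ x) i ≤ (g *ᵥ y) i := by
  rw [Matrix.mulVec, Matrix.mulVec, dotProduct, dotProduct]
  exact Finset.sum_le_sum fun k _ => mul_le_mul_of_nonneg_left (h k) (hg.1 i k)

lemma exists_pos_of_mem_simplex {x : Fin d → ℝ} (hx : x ∈ simplex d) : ∃ i, 0 < x i := by
  by_contra! h
  have h1 := hx.2
  rw [l1_of_mem_cone hx.1] at h1
  have := Finset.sum_nonpos fun i (_ : i ∈ Finset.univ) => h i
  linarith

lemma l1_mulVec_pos {g : Mat d} (hg : g ∈ semigroupS d) {x : Fin d → ℝ} (hx : x ∈ simplex d) :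
    0 < l1 (g *ᵥ x) := by
  obtain ⟨j, hj⟩ := exists_pos_of_mem_simplex hx
  obtain ⟨i, hi⟩ := hg.2 j
  rw [l1_of_mem_cone (mulVec_mem_cone hg hx.1)]
  exact Finset.sum_pos' (fun i _ => mulVec_mem_cone hg hx.1 i) ⟨i, Finset.mem_univ _,
    Finset.sum_pos' (fun k _ => mul_nonneg (hg.1 i k) (hx.1 k))
      ⟨j, Finset.mem_univ _, mul_pos hi hj⟩⟩

lemma projAct_mem_simplex {g : Mat d} (hg : g ∈ semigroupS d) {x : Fin d → ℝ}
    (hx : x ∈ simplex d) : projAct g x ∈ simplex d := by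
  have h := l1_mulVec_pos hg hx
  refine ⟨smul_mem_cone (inv_nonneg.2 h.le) (mulVec_mem_cone hg hx.1), ?_⟩
  rw [projAct, l1_smul, abs_of_pos (inv_pos.2 h), inv_mul_cancel₀ h.ne']

lemma projAct_mul (g : Mat d) {h : Mat d} (hh : h ∈ semigroupS d)
    {x : Fin d → ℝ} (hx : x ∈ simplex d) :
    projAct (g * h) x = projAct g (projAct h x) := by
  have hp := l1_mulVec_pos hh hx
  simp only [projAct, ← Matrix.mulVec_mulVec, Matrix.mulVec_smul, l1_smul, smul_smul]
  congr 1
  rw [abs_of_pos (inv_pos.2 hp), mul_inv, inv_inv, mul_right_comm, mul_inv_cancel₀ hp.ne', one_mul]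

/-- `x` and `y` are projectively `ε`-close: `a y ≤ x`, `b x ≤ y` with `ab ≥ 1 - ε`. The optimal
`-log (ab)` is the Hilbert distance of `x` and `y`. -/
def ProjClose (ε : ℝ) (x y : Fin d → ℝ) : Prop :=
  ∃ a b : ℝ, 0 ≤ a ∧ 0 ≤ b ∧ (∀ i, a * y i ≤ x i) ∧ (∀ i, b * x i ≤ y i) ∧ 1 - ε ≤ a * b

lemma projClose_one {x y : Fin d → ℝ} (hx : x ∈ cone d) (hy : y ∈ cone d) : ProjClose 1 x y :=
  ⟨0, 0, le_rfl, le_rfl, fun i => by simpa using hx i, fun i => by simpa using hy i, by simp⟩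

/-- Rescaling multiplies a and b by inverse factors, so ab is unchanged and the normalisation in
`projAct` costs nothing. -/
lemma ProjClose.smul {ε : ℝ} {x y : Fin d → ℝ} (h : ProjClose ε x y) {c c' : ℝ} (hc : 0 < c)
    (hc' : 0 < c') : ProjClose ε (c • x) (c' • y) := by
  obtain ⟨a, b, ha, hb, h1, h2, h3⟩ := h
  refine ⟨a * c / c', b * c' / c, by positivity, by positivity, fun i => ?_, fun i => ?_, ?_⟩
  · have := mul_le_mul_of_nonneg_left (h1 i) hc.le
    simp only [Pi.smul_apply, smul_eq_mul]
    calc a * c / c' * (c' * y i) = c * (a * y i) := by field_simp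
      _ ≤ _ := this
  · have := mul_le_mul_of_nonneg_left (h2 i) hc'.le
    simp only [Pi.smul_apply, smul_eq_mul]
    calc b * c' / c * (c * x i) = c' * (b * x i) := by field_simp
      _ ≤ _ := this
  · calc 1 - ε ≤ a * b := h3
      _ = _ := by field_simp

lemma ProjClose.mulVec {ε : ℝ} {x y : Fin d → ℝ} (h : ProjClose ε x y) {g : Mat d}
    (hg : g ∈ semigroupS d) : ProjClose ε (g *ᵥ x) (g *ᵥ y) := by
  obtain ⟨a, b, ha, hb, h1, h2, h3⟩ := h
  refine ⟨a, b, ha, hb, fun i => ?_, fun i => ?_, h3⟩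
  · simpa [Matrix.mulVec_smul] using mulVec_mono hg (x := a • y) (y := x) h1 i
  · simpa [Matrix.mulVec_smul] using mulVec_mono hg (x := b • x) (y := y) h2 i

lemma ProjClose.projAct {ε : ℝ} {x y : Fin d → ℝ} (h : ProjClose ε x y) {g : Mat d}
    (hg : g ∈ semigroupS d) (hx : x ∈ simplex d) (hy : y ∈ simplex d) :
    ProjClose ε (projAct g x) (projAct g y) :=
  (h.mulVec hg).smul (inv_pos.2 (l1_mulVec_pos hg hx)) (inv_pos.2 (l1_mulVec_pos hg hy))

/-- Matrices whose entries in a common row are comparable up to the factor `κ`. -/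
def rowComparable (d : ℕ) (κ : ℝ) : Set (Mat d) := {g | ∀ i j j', κ * g i j' ≤ g i j}

/-- The remainder x − a y is non-negative with mass 1 − a. Each column of g dominates κ times any
convex combination of its columns, in particular κ g y. Hence g (x − a y) ≥ κ (1 − a) g y, which is
added to a g y. -/
lemma rowComparable_mulVec {κ a : ℝ} {g : Mat d} (hg : g ∈ rowComparable d κ)
    {x y : Fin d → ℝ} (hx : x ∈ simplex d) (hy : y ∈ simplex d) (h : ∀ i, a * y i ≤ x i)
    (i : Fin d) : (a + κ * (1 - a)) * (g *ᵥ y) i ≤ (g *ᵥ x) i := by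
  have sx : ∑ j, x j = 1 := by rw [← l1_of_mem_cone hx.1, hx.2]
  have sy : ∑ j, y j = 1 := by rw [← l1_of_mem_cone hy.1, hy.2]
  have key : ∑ j, ∑ j', (x j - a * y j) * y j' * (κ * g i j')
      ≤ ∑ j, ∑ j', (x j - a * y j) * y j' * g i j :=
    Finset.sum_le_sum fun j _ => Finset.sum_le_sum fun j' _ =>
      mul_le_mul_of_nonneg_left (hg i j j') (mul_nonneg (sub_nonneg.2 (h j)) (hy.1 j'))
  have e1 : ∑ j, ∑ j', (x j - a * y j) * y j' * (κ * g i j') = κ * (1 - a) * (g *ᵥ y) i := by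
    calc _ = (∑ j, (x j - a * y j)) * ∑ j', y j' * (κ * g i j') := by
          rw [Finset.sum_mul_sum]; simp only [mul_assoc]
      _ = (1 - a) * ∑ j', κ * (g i j' * y j') := by
          rw [Finset.sum_sub_distrib, ← Finset.mul_sum, sx, sy, mul_one]
          congr 1; exact Finset.sum_congr rfl fun _ _ => by ring
      _ = _ := by rw [← Finset.mul_sum, Matrix.mulVec, dotProduct]; ring
  have e2 : ∑ j, ∑ j', (x j - a * y j) * y j' * g i j = (g *ᵥ x) i - a * (g *ᵥ y) i := by
    calc _ = ∑ j, (g i j * x j - a * (g i j * y j)) := by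
          refine Finset.sum_congr rfl fun j _ => ?_
          rw [← Finset.sum_mul, ← Finset.mul_sum, sy]; ring
      _ = _ := by rw [Finset.sum_sub_distrib, ← Finset.mul_sum]; rfl
  linarith

lemma le_one_of_smul_le {a : ℝ} {x y : Fin d → ℝ} (hx : x ∈ simplex d) (hy : y ∈ simplex d)
    (h : ∀ i, a * y i ≤ x i) : a ≤ 1 := by
  have := Finset.sum_le_sum fun i (_ : i ∈ Finset.univ) => h i
  rwa [← Finset.mul_sum, ← l1_of_mem_cone hx.1, ← l1_of_mem_cone hy.1, hx.2, hy.2, mul_one] at this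

lemma ProjClose.projAct_of_rowComparable {ε κ : ℝ} (hκ : 0 ≤ κ) (hκ1 : κ ≤ 1)
    {x y : Fin d → ℝ} (h : ProjClose ε x y) {g : Mat d} (hg : g ∈ semigroupS d)
    (hgκ : g ∈ rowComparable d κ) (hx : x ∈ simplex d) (hy : y ∈ simplex d) :
    ProjClose ((1 - κ ^ 2) * ε) (PosMatrix.projAct g x) (PosMatrix.projAct g y) := by
  refine ProjClose.smul ?_ (inv_pos.2 (l1_mulVec_pos hg hx)) (inv_pos.2 (l1_mulVec_pos hg hy))
  obtain ⟨a, b, ha, hb, h1, h2, h3⟩ := h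
  have ha1 := le_one_of_smul_le hx hy h1
  have hb1 := le_one_of_smul_le hy hx h2
  have ha' : 0 ≤ 1 - a := by linarith
  have hb' : 0 ≤ 1 - b := by linarith
  refine ⟨a + κ * (1 - a), b + κ * (1 - b), by positivity, by positivity,
    rowComparable_mulVec hgκ hx hy h1, rowComparable_mulVec hgκ hy hx h2, ?_⟩
  have hκ2 : 0 ≤ 1 - κ ^ 2 := by nlinarith
  have h4 := mul_le_mul_of_nonneg_left (show 1 - a * b ≤ ε by linarith) hκ2
  -- With a', b' the two new factors, this is exactly (1 − κ²)(1 − ab) − (1 − a'b').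
  have h5 : 0 ≤ κ * (1 - κ) * ((1 - a) * b + (1 - b) * a) :=
    mul_nonneg (mul_nonneg hκ (by linarith)) (by positivity)
  nlinarith

lemma min_two_neg_log_le {ε θ : ℝ} (hε : 0 ≤ ε) (hθ : 1 - ε ≤ θ) :
    min 2 (-Real.log θ) ≤ 4 * ε := by
  rcases le_or_gt (1 / 2) ε with h | h
  · exact (min_le_left _ _).trans (by linarith)
  · refine (min_le_right _ _).trans ?_
    have hθ0 : 0 < θ := by linarith
    have h1 := Real.one_sub_inv_le_log_of_pos hθ0
    have h2 : θ⁻¹ - 1 ≤ 2 * ε := by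
      rw [sub_le_iff_le_add, inv_le_iff_one_le_mul₀ hθ0]
      nlinarith
    linarith

lemma ProjClose.min_two_abs_rho_sub_le {ε : ℝ} (hε : 0 ≤ ε) {x y : Fin d → ℝ}
    (h : ProjClose ε x y) {g : Mat d} (hg : g ∈ semigroupS d)
    (hx : x ∈ simplex d) (hy : y ∈ simplex d) :
    min 2 |rho g x - rho g y| ≤ 4 * ε := by
  -- For large ε the truncation suffices; for small ε both a and b are positive and their logarithms
  -- can be used.
  rcases le_or_gt (1 / 2) ε with hε2 | hε2
  · exact (min_le_left _ _).trans (by linarith)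
  obtain ⟨a, b, ha, hb, h1, h2, h3⟩ := h
  have hab : 0 < a * b := by linarith
  have ha0 : 0 < a := pos_of_mul_pos_left hab hb
  have hb0 : 0 < b := pos_of_mul_pos_right hab ha
  have ha1 := Real.log_nonpos ha (le_one_of_smul_le hx hy h1)
  have hb1 := Real.log_nonpos hb (le_one_of_smul_le hy hx h2)
  have bound : ∀ {c : ℝ} {u v : Fin d → ℝ}, 0 < c → u ∈ simplex d → v ∈ simplex d →
      (∀ i, c * v i ≤ u i) → Real.log c + rho g v ≤ rho g u := by
    intro c u v hc hu hv huv
    have hv0 := l1_mulVec_pos hg hv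
    rw [rho, rho, ← Real.log_mul hc.ne' hv0.ne']
    refine Real.log_le_log (by positivity) ?_
    have := l1_mono (smul_mem_cone hc.le (mulVec_mem_cone hg hv.1))
      (fun i => by simpa [Matrix.mulVec_smul] using mulVec_mono hg (x := c • v) huv i)
    rwa [l1_smul, abs_of_pos hc] at this
  have k1 := bound ha0 hx hy h1
  have k2 := bound hb0 hy hx h2
  -- The two one-sided differences are at most −log a and −log b, each at most −log (ab) because a,
  -- b ≤ 1.
  refine (min_le_min_left 2 ?_).trans (min_two_neg_log_le hε h3)
  rw [Real.log_mul ha0.ne' hb0.ne']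
  rw [abs_le]
  constructor <;> linarith

end Cone

/-! ### Measurability, with the matrices involved kept explicit -/

section Measurability

variable {d : ℕ}

lemma measurable_mat_iff {Ω : Type*} {m : MeasurableSpace Ω} {f : Ω → Mat d} :
    Measurable f ↔ ∀ i j, Measurable fun ω => f ω i j := by
  constructor
  · intro h i j
    exact (measurable_pi_apply j).comp ((measurable_pi_apply (X := fun _ => Fin d → ℝ) i).comp h)
  · intro h
    exact measurable_pi_lambda (X := fun _ => Fin d → ℝ) _ fun i => measurable_pi_lambda _ (h i)

instance instMeasurableMul₂Mat : MeasurableMul₂ (Mat d) := by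
  refine ⟨measurable_mat_iff.2 fun i j => ?_⟩
  simp only [Matrix.mul_apply]
  exact Finset.measurable_sum _ fun k _ =>
    (measurable_mat_iff.1 measurable_fst i k).mul (measurable_mat_iff.1 measurable_snd k j)

variable {Ω : Type*} {m : MeasurableSpace Ω}

/-- The σ-algebra on Ω is arbitrary and only the indices 1, …, n are required. Applied to
sub-σ-algebras, this also records which matrices the product depends on, as `indepFun_of_disjoint`
needs. -/
lemma measurable_leftProd {g : ℕ → Ω → Mat d} {n : ℕ}
    (hg : ∀ i, 1 ≤ i → i ≤ n → Measurable (g i)) : Measurable (leftProd g n) := by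
  induction n with
  | zero => exact measurable_const
  | succ n ih =>
    exact (hg _ (by omega) le_rfl).mul (ih fun i h1 h2 => hg i h1 (by omega))

lemma measurable_mulVec {f : Ω → Mat d} {x : Ω → Fin d → ℝ} (hf : Measurable f)
    (hx : Measurable x) : Measurable fun ω => f ω *ᵥ x ω := by
  refine measurable_pi_lambda _ fun i => ?_
  simp only [Matrix.mulVec, dotProduct]
  exact Finset.measurable_sum _ fun k _ =>
    (measurable_mat_iff.1 hf i k).mul ((measurable_pi_apply k).comp hx)

lemma measurable_l1 : Measurable (l1 : (Fin d → ℝ) → ℝ) := by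
  unfold l1
  fun_prop

lemma measurable_rho {f : Ω → Mat d} {x : Ω → Fin d → ℝ} (hf : Measurable f)
    (hx : Measurable x) : Measurable fun ω => rho (f ω) (x ω) :=
  Real.measurable_log.comp (measurable_l1.comp (measurable_mulVec hf hx))

lemma measurable_projAct {f : Ω → Mat d} {x : Ω → Fin d → ℝ} (hf : Measurable f)
    (hx : Measurable x) : Measurable fun ω => projAct (f ω) (x ω) :=
  (measurable_l1.comp (measurable_mulVec hf hx)).inv.smul (measurable_mulVec hf hx)

lemma measurable_incr {g : ℕ → Ω → Mat d} (x : Fin d → ℝ) {n : ℕ}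
    (hg : ∀ i, 1 ≤ i → i ≤ n → Measurable (g i)) : Measurable (incr g x n) := by
  cases n with
  | zero => exact measurable_const
  | succ n =>
    exact measurable_rho (hg _ (by omega) le_rfl) (measurable_projAct
      (measurable_leftProd fun i h1 h2 => hg i h1 (by omega)) measurable_const)

lemma measurableSet_rowComparable (κ : ℝ) : MeasurableSet (rowComparable d κ) := by
  simp only [rowComparable, Set.ofPred_forall]
  refine MeasurableSet.iInter fun i => MeasurableSet.iInter fun j => MeasurableSet.iInter fun j' =>
    measurableSet_le ?_ ?_
  · exact (measurable_mat_iff.1 measurable_id i j').const_mul κ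
  · exact measurable_mat_iff.1 measurable_id i j

end Measurability

/-! ### Contraction along products of matrices -/

section Products

variable {Ω : Type*} {d : ℕ} {g : ℕ → Ω → Mat d}

lemma leftProd_add (g : ℕ → Ω → Mat d) (p n : ℕ) (ω : Ω) :
    leftProd g (p + n) ω = leftProd (fun i => g (p + i)) n ω * leftProd g p ω := by
  induction n with
  | zero => simp [leftProd]
  | succ n ih =>
    rw [← add_assoc, leftProd, leftProd, ih, mul_assoc]
    rfl

lemma leftProd_mem_semigroupS {ω : Ω} (hS : ∀ n, g n ω ∈ semigroupS d) (n : ℕ) :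
    leftProd g n ω ∈ semigroupS d := by
  induction n with
  | zero => exact one_mem_semigroupS
  | succ n ih => exact mul_mem_semigroupS (hS _) ih

open Classical in
/-- A factor by which `h` contracts projective closeness. -/
noncomputable def contractionFactor (κ : ℝ) (h : Mat d) : ℝ :=
  if h ∈ rowComparable d κ then 1 - κ ^ 2 else 1

/-- The product of the contraction factors of the first `M` blocks of length `n₀`. -/
noncomputable def blockContraction (κ : ℝ) (n₀ : ℕ) (g : ℕ → Ω → Mat d) (M : ℕ) (ω : Ω) : ℝ :=
  ∏ m ∈ Finset.range M, contractionFactor κ (leftProd (fun i => g (n₀ * m + i)) n₀ ω)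

lemma contractionFactor_nonneg {κ : ℝ} (hκ : 0 ≤ κ) (hκ1 : κ ≤ 1) (h : Mat d) :
    0 ≤ contractionFactor κ h := by
  unfold contractionFactor
  split_ifs <;> nlinarith

lemma contractionFactor_le_one (κ : ℝ) (h : Mat d) :
    contractionFactor κ h ≤ 1 := by
  unfold contractionFactor
  split_ifs <;> nlinarith [sq_nonneg κ]

lemma measurable_contractionFactor (κ : ℝ) :
    Measurable (contractionFactor κ : Mat d → ℝ) :=
  Measurable.ite (measurableSet_rowComparable κ) measurable_const measurable_const

lemma blockContraction_nonneg {κ : ℝ} (hκ : 0 ≤ κ) (hκ1 : κ ≤ 1) (n₀ M : ℕ) (ω : Ω) :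
    0 ≤ blockContraction κ n₀ g M ω :=
  Finset.prod_nonneg fun _ _ => contractionFactor_nonneg hκ hκ1 _

lemma blockContraction_le_one {κ : ℝ} (hκ : 0 ≤ κ) (hκ1 : κ ≤ 1) (n₀ M : ℕ) (ω : Ω) :
    blockContraction κ n₀ g M ω ≤ 1 :=
  Finset.prod_le_one (fun _ _ => contractionFactor_nonneg hκ hκ1 _)
    fun _ _ => contractionFactor_le_one _ _

lemma measurable_blockContraction {m : MeasurableSpace Ω} (κ : ℝ) (n₀ M : ℕ)
    (hg : ∀ i, 1 ≤ i → i ≤ n₀ * M → Measurable (g i)) :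
    Measurable (blockContraction κ n₀ g M) := by
  unfold blockContraction
  refine Finset.measurable_fun_prod _ fun l hl => (measurable_contractionFactor κ).comp
    (measurable_leftProd fun i h1 h2 => hg _ (by omega) ?_)
  have : l + 1 ≤ M := Finset.mem_range.1 hl
  calc n₀ * l + i ≤ n₀ * (l + 1) := by rw [mul_add]; omega
    _ ≤ _ := Nat.mul_le_mul_left _ this

lemma ProjClose.projAct_contractionFactor {ε κ : ℝ} (hκ : 0 ≤ κ) (hκ1 : κ ≤ 1)
    {x y : Fin d → ℝ} (h : ProjClose ε x y) {h' : Mat d} (hS : h' ∈ semigroupS d)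
    (hx : x ∈ simplex d) (hy : y ∈ simplex d) :
    ProjClose (ε * contractionFactor κ h') (PosMatrix.projAct h' x) (PosMatrix.projAct h' y) := by
  unfold contractionFactor
  split_ifs with hc
  · rw [mul_comm]
    exact h.projAct_of_rowComparable hκ hκ1 hS hc hx hy
  · rw [mul_one]
    exact h.projAct hS hx hy

/-- Any two points of the cone are 1-close; each complete block multiplies this by its factor, and
the leftover matrices do no harm. -/
lemma projClose_leftProd {κ : ℝ} (hκ : 0 ≤ κ) (hκ1 : κ ≤ 1) (n₀ M n : ℕ) (hn : n₀ * M ≤ n) {ω : Ω}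
    (hS : ∀ n, g n ω ∈ semigroupS d) {x y : Fin d → ℝ} (hx : x ∈ simplex d)
    (hy : y ∈ simplex d) :
    ProjClose (blockContraction κ n₀ g M ω) (projAct (leftProd g n ω) x)
      (projAct (leftProd g n ω) y) := by
  have step : ∀ M, ProjClose (blockContraction κ n₀ g M ω) (projAct (leftProd g (n₀ * M) ω) x)
      (projAct (leftProd g (n₀ * M) ω) y) := by
    intro M
    have hL := leftProd_mem_semigroupS hS
    induction M with
    | zero =>
      simpa [blockContraction] using projClose_one (projAct_mem_simplex (hL 0) hx).1
        (projAct_mem_simplex (hL 0) hy).1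
    | succ M ih =>
      rw [mul_add, mul_one, leftProd_add, projAct_mul _ (hL _) hx, projAct_mul _ (hL _) hy,
        blockContraction, Finset.prod_range_succ]
      exact ih.projAct_contractionFactor hκ hκ1 (leftProd_mem_semigroupS (fun i => hS _) _)
        (projAct_mem_simplex (hL _) hx) (projAct_mem_simplex (hL _) hy)
  obtain ⟨l, rfl⟩ := Nat.exists_eq_add_of_le hn
  have hL := leftProd_mem_semigroupS hS (n₀ * M)
  rw [leftProd_add, projAct_mul _ hL hx, projAct_mul _ hL hy]
  exact (step M).projAct (leftProd_mem_semigroupS (fun i => hS _) _)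
    (projAct_mem_simplex hL hx) (projAct_mem_simplex hL hy)

lemma chain_mem_simplex {ω : Ω} (hS : ∀ n, g n ω ∈ semigroupS d) {x : Fin d → ℝ}
    (hx : x ∈ simplex d) (n : ℕ) : chain g x n ω ∈ simplex d :=
  projAct_mem_simplex (leftProd_mem_semigroupS hS n) hx

/-- From time p on, the original and restarted chains use the same matrices, starting from X_p and
x. Increment n + 1 sees the positions after n steps, hence n / n₀ complete blocks. -/
lemma min_two_abs_incr_sub_le {κ : ℝ} (hκ : 0 ≤ κ) (hκ1 : κ ≤ 1) (n₀ p n : ℕ) {ω : Ω}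
    (hS : ∀ n, g n ω ∈ semigroupS d) {x : Fin d → ℝ} (hx : x ∈ simplex d) :
    min 2 |incr g x (p + (n + 1)) ω - incr (fun i => g (p + i)) x (n + 1) ω|
      ≤ 4 * blockContraction κ n₀ (fun i => g (p + i)) (n / n₀) ω := by
  have hS' : ∀ n, g (p + n) ω ∈ semigroupS d := fun n => hS _
  have hL := leftProd_mem_semigroupS hS p
  have hL' := leftProd_mem_semigroupS (g := fun i => g (p + i)) hS' n
  have hX := chain_mem_simplex hS hx p
  rw [← add_assoc, incr, incr, chain, leftProd_add, projAct_mul _ hL hx]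
  exact (projClose_leftProd hκ hκ1 n₀ (n / n₀) n (Nat.mul_div_le _ _) hS' hX hx).min_two_abs_rho_sub_le
    (blockContraction_nonneg hκ hκ1 _ _ _) (hS _) (projAct_mem_simplex hL' hX)
    (projAct_mem_simplex hL' hx)

end Products

/-! ### Independence and exponential forgetting -/

section Probability

variable {Ω : Type*} [MeasurableSpace Ω] {P : Measure Ω} {d : ℕ}
  {μ : Measure (Mat d)} {g : ℕ → Ω → Mat d}

/-- Functions of the matrices with indices in two disjoint sets are independent. -/
lemma indepFun_of_disjoint {β γ : Type*} [MeasurableSpace β] [MeasurableSpace γ]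
    (hmeas : ∀ n, Measurable (g n)) (hindep : iIndepFun g P) {S T : Set ℕ} (hST : Disjoint S T)
    {f : Ω → β} {f' : Ω → γ}
    (hf : ∀ m : MeasurableSpace Ω, (∀ i ∈ S, Measurable[m] (g i)) → Measurable[m] f)
    (hf' : ∀ m : MeasurableSpace Ω, (∀ i ∈ T, Measurable[m] (g i)) → Measurable[m] f') :
    IndepFun f f' P := by
  have h := indep_iSup_of_disjoint (fun i => (hmeas i).comap_le) hindep.iIndep hST
  rw [IndepFun_iff_Indep]
  refine indep_of_indep_of_le_left (indep_of_indep_of_le_right h ?_) ?_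
  · refine (hf' _ fun i hi => ?_).comap_le
    exact (comap_measurable (g i)).mono (le_iSup₂_of_le i hi le_rfl) le_rfl
  · refine (hf _ fun i hi => ?_).comap_le
    exact (comap_measurable (g i)).mono (le_iSup₂_of_le i hi le_rfl) le_rfl

variable [IsProbabilityMeasure P]

lemma map_leftProd (hmeas : ∀ n, Measurable (g n)) (hindep : iIndepFun g P)
    (hlaw : ∀ n, P.map (g n) = μ) (n : ℕ) : P.map (leftProd g n) = convPow μ n := by
  induction n with
  | zero =>
    change P.map (fun _ => 1) = _
    rw [Measure.map_const]
    simp [convPow]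
  | succ n ih =>
    have hi : IndepFun (g (n + 1)) (leftProd g n) P :=
      indepFun_of_disjoint hmeas hindep (S := {n + 1}) (T := Set.Icc 1 n)
        (Set.disjoint_left.2 fun i hi hi' => by
          rw [Set.mem_singleton_iff] at hi; have := hi'.2; omega)
        (fun m h => h _ rfl) (fun m h => measurable_leftProd fun i h1 h2 => h i ⟨h1, h2⟩)
    have := hi.map_mul_eq_map_mconv_map (hmeas _) (measurable_leftProd fun i _ _ => hmeas i)
    rw [hlaw, ih] at this
    exact this

lemma integral_blockContraction (hmeas : ∀ n, Measurable (g n)) (hindep : iIndepFun g P)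
    (hlaw : ∀ n, P.map (g n) = μ) (κ : ℝ) (n₀ M : ℕ) :
    ∫ ω, blockContraction κ n₀ g M ω ∂P = (∫ h, contractionFactor κ h ∂(convPow μ n₀)) ^ M := by
  induction M with
  | zero => simp [blockContraction]
  | succ M ih =>
    have hm : Measurable (leftProd (fun i => g (n₀ * M + i)) n₀) :=
      measurable_leftProd fun i _ _ => hmeas _
    have hc := measurable_contractionFactor (d := d) κ
    have hi : IndepFun (blockContraction κ n₀ g M)
        (fun ω => contractionFactor κ (leftProd (fun i => g (n₀ * M + i)) n₀ ω)) P :=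
      indepFun_of_disjoint hmeas hindep (S := Set.Iic (n₀ * M)) (T := Set.Ioi (n₀ * M))
        (Set.disjoint_left.2 fun i hi hi' => not_le.2 (Set.mem_Ioi.1 hi') hi)
        (fun m h => measurable_blockContraction κ n₀ M fun i _ h2 => h i h2)
        (fun m h => hc.comp (measurable_leftProd fun i h1 _ => h _ (by simp; omega)))
    have hmap := map_leftProd (g := fun i => g (n₀ * M + i)) (fun i => hmeas _)
      (hindep.precomp (add_right_injective _)) (fun i => hlaw _) n₀
    have := hi.integral_fun_mul_eq_mul_integral
      (measurable_blockContraction κ n₀ M fun i _ _ => hmeas i).aestronglyMeasurable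
      (hc.comp hm).aestronglyMeasurable
    rw [pow_succ, ← ih, ← hmap, integral_map hm.aemeasurable hc.aestronglyMeasurable, ← this]
    simp only [blockContraction, Finset.prod_range_succ]

lemma isProbabilityMeasure_convPow [IsProbabilityMeasure μ] (n : ℕ) :
    IsProbabilityMeasure (convPow μ n) := by
  induction n with
  | zero => exact Measure.dirac.isProbabilityMeasure
  | succ n ih => exact Measure.probabilitymeasure_of_probabilitymeasures_mconv _ _

lemma interiorS_subset_iUnion_rowComparable :
    interiorS d ⊆ ⋃ k : ℕ, rowComparable d (1 / ((k : ℝ) + 2)) := by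
  intro g hg
  have h1 : ∀ i j j', ∃ k : ℕ, ∀ l ≥ k, 1 / ((l : ℝ) + 2) * g i j' ≤ g i j := by
    intro i j j'
    obtain ⟨k, hk⟩ := exists_nat_ge (g i j' / g i j)
    refine ⟨k, fun l hl => ?_⟩
    rw [div_le_iff₀ (hg i j)] at hk
    have hl' : (k : ℝ) ≤ l := by exact_mod_cast hl
    rw [one_div, inv_mul_le_iff₀ (by positivity)]
    nlinarith [hg i j]
  choose k hk using h1
  -- The sum of the finitely many thresholds dominates each of them.
  refine Set.mem_iUnion.2 ⟨∑ i, ∑ j, ∑ j', k i j j', fun i j j' => hk i j j' _ ?_⟩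
  calc k i j j' ≤ ∑ j', k i j j' := Finset.single_le_sum (fun _ _ => Nat.zero_le _) (Finset.mem_univ j')
    _ ≤ ∑ j, ∑ j', k i j j' := Finset.single_le_sum (f := fun j => ∑ j', k i j j')
        (fun _ _ => Nat.zero_le _) (Finset.mem_univ j)
    _ ≤ _ := Finset.single_le_sum (f := fun i => ∑ j, ∑ j', k i j j')
        (fun _ _ => Nat.zero_le _) (Finset.mem_univ i)

/-- The positive matrices are covered by countably many row-comparable classes, so one class is
charged, and the mean factor is 1 − κ² times its mass. It stays positive because κ ≤ 1/2; this
allows division by it later. -/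
lemma exists_integral_contractionFactor_lt_one [IsProbabilityMeasure μ] {n₀ : ℕ}
    (h : 0 < convPow μ n₀ (interiorS d)) :
    ∃ κ : ℝ, 0 ≤ κ ∧ κ ≤ 1 ∧ 0 < ∫ h, contractionFactor κ h ∂(convPow μ n₀) ∧
      ∫ h, contractionFactor κ h ∂(convPow μ n₀) < 1 := by
  have := isProbabilityMeasure_convPow (μ := μ) n₀
  have hk : ∃ k : ℕ, 0 < convPow μ n₀ (rowComparable d (1 / ((k : ℝ) + 2))) := by
    by_contra! hc
    refine h.ne' (measure_mono_null interiorS_subset_iUnion_rowComparable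
      (measure_iUnion_null fun k => le_antisymm (hc k) zero_le))
  obtain ⟨k, hk⟩ := hk
  set κ : ℝ := 1 / ((k : ℝ) + 2) with hκ
  have hκ0 : 0 < κ := by positivity
  have hκ1 : κ ≤ 1 / 2 := by
    rw [hκ]; gcongr; linarith [(Nat.cast_nonneg k : (0 : ℝ) ≤ k)]
  have hr : 0 < (convPow μ n₀).real (rowComparable d κ) :=
    ENNReal.toReal_pos hk.ne' (measure_ne_top _ _)
  have hr1 : (convPow μ n₀).real (rowComparable d κ) ≤ 1 := measureReal_le_one
  have e : (contractionFactor κ : Mat d → ℝ)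
      = fun h => 1 - (rowComparable d κ).indicator (fun _ => κ ^ 2) h := by
    ext h
    by_cases hh : h ∈ rowComparable d κ <;> simp [contractionFactor, hh]
  have : ∫ h, contractionFactor κ h ∂(convPow μ n₀)
      = 1 - (convPow μ n₀).real (rowComparable d κ) * κ ^ 2 := by
    rw [e, integral_sub (integrable_const _)
      ((integrable_const _).indicator (measurableSet_rowComparable κ)),
      integral_indicator_const _ (measurableSet_rowComparable κ)]
    simp
  refine ⟨κ, hκ0.le, by linarith, ?_, ?_⟩ <;> rw [this]
  · nlinarith
  · have := mul_pos hr (pow_pos hκ0 2)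
    linarith

/-- The increments forget the position of the chain exponentially fast. -/
theorem exists_integral_min_two_abs_incr_sub_le [IsProbabilityMeasure μ]
    (hμS : ∀ᵐ h ∂μ, h ∈ semigroupS d) (hmeas : ∀ n, Measurable (g n)) (hindep : iIndepFun g P)
    (hlaw : ∀ n, P.map (g n) = μ) (hP3 : P3 μ) :
    ∃ C r : ℝ, 0 < C ∧ 0 < r ∧ r < 1 ∧ ∀ x ∈ simplex d, ∀ p n : ℕ,
      ∫ ω, min 2 |incr g x (p + n) ω - incr (fun i => g (p + i)) x n ω| ∂P ≤ C * r ^ n := by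
  obtain ⟨n₀, hn₀, hpos⟩ := hP3
  obtain ⟨κ, hκ, hκ1, hr0, hr1⟩ := exists_integral_contractionFactor_lt_one hpos
  set r₀ := ∫ h, contractionFactor κ h ∂(convPow μ n₀) with hr₀
  have hn₀' : (n₀ : ℝ) ≠ 0 := by positivity
  -- The rate per step is the n₀-th root of the mean contraction per block.
  set r : ℝ := r₀ ^ (1 / (n₀ : ℝ)) with hr
  have hrpos : 0 < r := Real.rpow_pos_of_pos hr0 _
  have hrlt : r < 1 := Real.rpow_lt_one hr0.le hr1 (by positivity)
  have hrn : r ^ n₀ = r₀ := by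
    rw [hr, ← Real.rpow_natCast, ← Real.rpow_mul hr0.le, one_div, inv_mul_cancel₀ hn₀',
      Real.rpow_one]
  have hS : ∀ᵐ ω ∂P, ∀ n, g n ω ∈ semigroupS d := by
    rw [ae_all_iff]
    intro n
    rw [← hlaw n] at hμS
    exact ae_of_ae_map (hmeas n).aemeasurable hμS
  -- The factor 1/r₀ pays for the incomplete last block, and 1/r for the shift from n to n + 1.
  refine ⟨4 / (r₀ * r), r, by positivity, hrpos, hrlt, fun x hx p n => ?_⟩
  cases n with
  -- The restarted increment at time 0 is 0 by convention, so nothing is coupled here and only the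
  -- bound 2 is available.
  | zero =>
    calc _ ≤ ∫ ω, (2 : ℝ) ∂P := integral_mono_of_nonneg
          (ae_of_all _ fun ω => le_min (by norm_num) (abs_nonneg _)) (integrable_const _)
          (ae_of_all _ fun ω => min_le_left _ _)
      _ ≤ 4 / (r₀ * r) * r ^ 0 := by
          rw [integral_const, pow_zero, mul_one, le_div_iff₀ (by positivity)]
          simp
          nlinarith
  | succ n =>
    have hm : Measurable (blockContraction κ n₀ (fun i => g (p + i)) (n / n₀)) :=
      measurable_blockContraction κ n₀ _ fun i _ _ => hmeas _
    have hint : Integrable (blockContraction κ n₀ (fun i => g (p + i)) (n / n₀)) P :=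
      Integrable.of_bound hm.aestronglyMeasurable 1 (ae_of_all _ fun ω => by
        rw [Real.norm_of_nonneg (blockContraction_nonneg hκ hκ1 _ _ _)]
        exact blockContraction_le_one hκ hκ1 _ _ _)
    calc _ ≤ ∫ ω, 4 * blockContraction κ n₀ (fun i => g (p + i)) (n / n₀) ω ∂P :=
          integral_mono_of_nonneg
            (ae_of_all _ fun ω => le_min (by norm_num) (abs_nonneg _)) (hint.const_mul 4)
            (hS.mono fun ω hω => min_two_abs_incr_sub_le hκ hκ1 n₀ p n hω hx)
      _ = 4 * r₀ ^ (n / n₀) := by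
          rw [integral_const_mul, integral_blockContraction (fun i => hmeas _)
            (hindep.precomp (add_right_injective _)) (fun i => hlaw _)]
      _ ≤ 4 / (r₀ * r) * r ^ (n + 1) := by
          have h1 : r₀ ^ (n / n₀) * r₀ ≤ r ^ n := by
            rw [← pow_succ, ← hrn, ← pow_mul]
            exact pow_le_pow_of_le_one hrpos.le hrlt.le (Nat.lt_mul_div_succ n hn₀).le
          rw [pow_succ, div_mul_eq_mul_div, le_div_iff₀ (by positivity)]
          nlinarith

end Probability

/-! ### Decoupling the characteristic functions -/

section Decoupling

variable {Ω : Type*} {d : ℕ}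

lemma sum_sum_block (f : ℕ → ℝ) (j : ℕ → ℕ) (M₁ M₂ : ℕ)
    (hj : StrictMonoOn j (Set.Iic (M₁ + M₂))) :
    ∑ m : Fin M₂, ∑ l ∈ block j (M₁ + m), f l = ∑ l ∈ Finset.Ico (j M₁) (j (M₁ + M₂)), f l := by
  induction M₂ with
  | zero => simp
  | succ M ih =>
    rw [Fin.sum_univ_castSucc]
    simp only [Fin.val_castSucc, Fin.val_last]
    rw [ih (hj.mono (Set.Iic_subset_Iic.2 (by omega))), block, add_assoc]
    exact Finset.sum_Ico_consecutive _
      (hj.monotoneOn (Set.mem_Iic.2 (by omega)) (Set.mem_Iic.2 (by omega)) (by omega))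
      (hj.monotoneOn (Set.mem_Iic.2 (by omega)) (Set.mem_Iic.2 (by omega)) (by omega))

/-- The second vector of block sums, for the chain restarted at `x` at time `p`. -/
noncomputable def restartedDotA2 (g : ℕ → Ω → Mat d) (x : Fin d → ℝ) (j : ℕ → ℕ) (k p M₁ : ℕ)
    {M₂ : ℕ} (t : Fin M₂ → ℝ) (ω : Ω) : ℝ :=
  ∑ m : Fin M₂, t m * ∑ l ∈ block j (M₁ + m), incr (fun i => g (p + i)) x (k + l - p) ω

lemma norm_exp_I_mul_sub_le (a b : ℝ) :
    ‖Complex.exp (Complex.I * a) - Complex.exp (Complex.I * b)‖ ≤ min 2 |a - b| := by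
  have h1 : ∀ c : ℝ, ‖Complex.exp (Complex.I * c)‖ = 1 := fun c => by
    rw [mul_comm]; exact Complex.norm_exp_ofReal_mul_I c
  refine le_min ((norm_sub_le _ _).trans (by rw [h1, h1]; norm_num)) ?_
  have : Complex.exp (Complex.I * a) - Complex.exp (Complex.I * b)
      = Complex.exp (Complex.I * b) * (Complex.exp (Complex.I * ((a - b : ℝ) : ℂ)) - 1) := by
    rw [mul_sub, ← Complex.exp_add, mul_one]
    congr 2
    push_cast
    ring
  rw [this, norm_mul, h1, one_mul]
  exact Real.norm_exp_I_mul_ofReal_sub_one_le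

/-- Subadditivity of the truncation lets the comparison of block sums be made one increment at a
time. -/
lemma min_two_sum_le {ι : Type*} (s : Finset ι) (f : ι → ℝ) (hf : ∀ i, 0 ≤ f i) :
    min 2 (∑ i ∈ s, f i) ≤ ∑ i ∈ s, min 2 (f i) := by
  by_cases h : ∃ i ∈ s, 2 ≤ f i
  · obtain ⟨i, hi, h2⟩ := h
    calc _ ≤ 2 := min_le_left _ _
      _ = min 2 (f i) := (min_eq_left h2).symm
      _ ≤ _ := Finset.single_le_sum (f := fun i => min 2 (f i))
        (fun i _ => le_min (by norm_num) (hf i)) hi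
  · push Not at h
    refine (min_le_right _ _).trans (Finset.sum_le_sum fun i hi => ?_)
    rw [min_eq_right (h i hi).le]

lemma norm_exp_dotA2_sub_le (g : ℕ → Ω → Mat d) (x : Fin d → ℝ) (j : ℕ → ℕ) (k p M₁ M₂ : ℕ)
    (hj : StrictMonoOn j (Set.Iic (M₁ + M₂))) (t : Fin M₂ → ℝ) (ht : ∀ m, |t m| ≤ 1) (ω : Ω) :
    ‖Complex.exp (Complex.I * (dotA2 g x j k M₁ t ω : ℂ))
        - Complex.exp (Complex.I * (restartedDotA2 g x j k p M₁ t ω : ℂ))‖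
      ≤ ∑ l ∈ Finset.Ico (j M₁) (j (M₁ + M₂)),
          min 2 |incr g x (k + l) ω - incr (fun i => g (p + i)) x (k + l - p) ω| := by
  refine (norm_exp_I_mul_sub_le _ _).trans
    (le_trans (min_le_min_left _ ?_) (min_two_sum_le _ _ fun _ => abs_nonneg _))
  rw [← sum_sum_block _ _ _ _ hj, dotA2, restartedDotA2, ← Finset.sum_sub_distrib]
  refine (Finset.abs_sum_le_sum_abs _ _).trans (Finset.sum_le_sum fun m _ => ?_)
  rw [← mul_sub, abs_mul, blockSum, ← Finset.sum_sub_distrib]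
  calc _ ≤ 1 * |∑ l ∈ block j (M₁ + m),
        (incr g x (k + l) ω - incr (fun i => g (p + i)) x (k + l - p) ω)| :=
        mul_le_mul_of_nonneg_right (ht m) (abs_nonneg _)
    _ ≤ _ := by rw [one_mul]; exact Finset.abs_sum_le_sum_abs _ _

lemma measurable_dotA1 {m : MeasurableSpace Ω} {g : ℕ → Ω → Mat d} (x : Fin d → ℝ) (j : ℕ → ℕ)
    {M₁ : ℕ} (hj : StrictMonoOn j (Set.Iic M₁)) (s : Fin M₁ → ℝ)
    (hg : ∀ i, i ≤ j M₁ → Measurable (g i)) : Measurable (dotA1 g x j s) := by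
  refine Finset.measurable_fun_sum _ fun m _ => Measurable.const_mul
    (Finset.measurable_fun_sum _ fun l hl => measurable_incr x fun i _ h2 => hg i ?_) _
  have h1 : j (m + 1) ≤ j M₁ := hj.monotoneOn (Set.mem_Iic.2 m.2) (Set.mem_Iic.2 le_rfl) m.2
  have h3 := (Finset.mem_Ico.1 hl).2
  omega

lemma measurable_dotA2 {m : MeasurableSpace Ω} {g : ℕ → Ω → Mat d} (x : Fin d → ℝ) (j : ℕ → ℕ)
    (k M₁ : ℕ) {M₂ : ℕ} (t : Fin M₂ → ℝ)
    (hg : ∀ i, Measurable (g i)) : Measurable (dotA2 g x j k M₁ t) :=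
  Finset.measurable_fun_sum _ fun _ _ => Measurable.const_mul
    (Finset.measurable_fun_sum _ fun _ _ => measurable_incr x fun i _ _ => hg i) _

lemma measurable_restartedDotA2 {m : MeasurableSpace Ω} {g : ℕ → Ω → Mat d} (x : Fin d → ℝ)
    (j : ℕ → ℕ) (k p M₁ : ℕ) {M₂ : ℕ} (t : Fin M₂ → ℝ)
    (hg : ∀ i, p < i → Measurable (g i)) : Measurable (restartedDotA2 g x j k p M₁ t) :=
  Finset.measurable_fun_sum _ fun _ _ => Measurable.const_mul
    (Finset.measurable_fun_sum _ fun _ _ => measurable_incr x fun i h1 _ => hg _ (by omega)) _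

lemma measurable_cexp_I_mul {m : MeasurableSpace Ω} {f : Ω → ℝ} (hf : Measurable f) :
    Measurable fun ω => Complex.exp (Complex.I * (f ω : ℂ)) :=
  Complex.measurable_exp.comp ((Complex.measurable_ofReal.comp hf).const_mul _)

variable [MeasurableSpace Ω] {P : Measure Ω} [IsProbabilityMeasure P]

/-- The covariance of `F₁` and `F₂` is controlled by the distance of `F₂` to a variable
independent of `F₁`. -/
lemma norm_integral_mul_sub_le {F₁ F₂ F : Ω → ℂ} (h₁ : Measurable F₁) (h₂ : Measurable F₂)
    (h : Measurable F) (b₁ : ∀ ω, ‖F₁ ω‖ = 1) (b₂ : ∀ ω, ‖F₂ ω‖ = 1) (b : ∀ ω, ‖F ω‖ = 1)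
    (hi : IndepFun F₁ F P) :
    ‖∫ ω, F₁ ω * F₂ ω ∂P - (∫ ω, F₁ ω ∂P) * ∫ ω, F₂ ω ∂P‖ ≤ 2 * ∫ ω, ‖F₂ ω - F ω‖ ∂P := by
  have bdd : ∀ {G : Ω → ℂ}, Measurable G → (∀ ω, ‖G ω‖ = 1) → Integrable G P :=
    fun hG bG => Integrable.of_bound hG.aestronglyMeasurable 1 (ae_of_all _ fun ω => (bG ω).le)
  have i12 : Integrable (fun ω => F₁ ω * F₂ ω) P :=
    bdd (h₁.mul h₂) fun ω => by rw [norm_mul, b₁, b₂, one_mul]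
  have i1 : Integrable (fun ω => F₁ ω * F ω) P :=
    bdd (h₁.mul h) fun ω => by rw [norm_mul, b₁, b, one_mul]
  have e := hi.integral_fun_mul_eq_mul_integral h₁.aestronglyMeasurable h.aestronglyMeasurable
  -- The covariance of F₁ and F vanishes by independence, so F may be subtracted from F₂.
  have key : ∫ ω, F₁ ω * F₂ ω ∂P - (∫ ω, F₁ ω ∂P) * ∫ ω, F₂ ω ∂P
      = ∫ ω, F₁ ω * (F₂ ω - F ω) ∂P - (∫ ω, F₁ ω ∂P) * ∫ ω, (F₂ ω - F ω) ∂P := by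
    simp only [mul_sub]
    rw [integral_sub i12 i1, integral_sub (bdd h₂ b₂) (bdd h b), e]
    ring
  have n1 : ‖∫ ω, F₁ ω * (F₂ ω - F ω) ∂P‖ ≤ ∫ ω, ‖F₂ ω - F ω‖ ∂P :=
    (norm_integral_le_integral_norm _).trans (by simp only [norm_mul, b₁, one_mul, le_refl])
  have n2 : ‖∫ ω, F₁ ω ∂P‖ ≤ 1 :=
    (norm_integral_le_integral_norm _).trans (by simp [b₁])
  have n3 : ‖∫ ω, (F₂ ω - F ω) ∂P‖ ≤ ∫ ω, ‖F₂ ω - F ω‖ ∂P := norm_integral_le_integral_norm _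
  rw [key]
  refine (norm_sub_le _ _).trans ?_
  rw [norm_mul]
  have := mul_le_mul n2 n3 (norm_nonneg _) zero_le_one
  linarith

lemma norm_phi_sub_le {g : ℕ → Ω → Mat d} (hmeas : ∀ n, Measurable (g n)) (hindep : iIndepFun g P)
    (x : Fin d → ℝ) (j : ℕ → ℕ) (k M₁ M₂ : ℕ) (hj : StrictMonoOn j (Set.Iic (M₁ + M₂)))
    (s : Fin M₁ → ℝ) (t : Fin M₂ → ℝ) (ht : ∀ m, |t m| ≤ 1) :
    ‖phi P g x j k s t - phi1 P g x j s * phi2 P g x j k M₁ t‖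
      ≤ 2 * ∑ l ∈ Finset.Ico (j M₁) (j (M₁ + M₂)),
          ∫ ω, min 2 |incr g x (k + l) ω - incr (fun i => g (j M₁ + i)) x (k + l - j M₁) ω| ∂P := by
  have hj₁ : StrictMonoOn j (Set.Iic M₁) := hj.mono (Set.Iic_subset_Iic.2 (by omega))
  have nrm : ∀ c : ℝ, ‖Complex.exp (Complex.I * c)‖ = 1 := fun c => by
    rw [mul_comm]; exact Complex.norm_exp_ofReal_mul_I c
  have m1 := measurable_cexp_I_mul (measurable_dotA1 x j hj₁ s fun i _ => hmeas i)
  have m2 := measurable_cexp_I_mul (measurable_dotA2 x j k M₁ t hmeas)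
  have m3 := measurable_cexp_I_mul
    (measurable_restartedDotA2 x j k (j M₁) M₁ t fun i _ => hmeas i)
  have hi : IndepFun (fun ω => Complex.exp (Complex.I * (dotA1 g x j s ω : ℂ)))
      (fun ω => Complex.exp (Complex.I * (restartedDotA2 g x j k (j M₁) M₁ t ω : ℂ))) P :=
    indepFun_of_disjoint hmeas hindep (S := Set.Iic (j M₁)) (T := Set.Ioi (j M₁))
      (Set.disjoint_left.2 fun i hi hi' => not_le.2 (Set.mem_Ioi.1 hi') hi)
      (fun m h => measurable_cexp_I_mul (measurable_dotA1 x j hj₁ s fun i hi => h i hi))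
      (fun m h => measurable_cexp_I_mul (measurable_restartedDotA2 x j k _ M₁ t fun i hi => h i hi))
  have hmi : ∀ l, Integrable (fun ω => min 2
      |incr g x (k + l) ω - incr (fun i => g (j M₁ + i)) x (k + l - j M₁) ω|) P := by
    intro l
    refine Integrable.of_bound (measurable_const.min ((measurable_incr x fun i _ _ => hmeas i).sub
      (measurable_incr x fun i _ _ => hmeas _)).abs).aestronglyMeasurable 2 (ae_of_all _ fun ω => ?_)
    rw [Real.norm_of_nonneg (le_min (by norm_num) (abs_nonneg _))]
    exact min_le_left _ _
  simp only [phi, phi1, phi2, mul_add, Complex.exp_add]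
  refine (norm_integral_mul_sub_le m1 m2 m3 (fun _ => nrm _) (fun _ => nrm _) (fun _ => nrm _)
    hi).trans (mul_le_mul_of_nonneg_left ?_ zero_le_two)
  rw [← integral_finsetSum _ fun l _ => hmi l]
  exact integral_mono_of_nonneg (ae_of_all _ fun _ => norm_nonneg _)
    (integrable_finsetSum _ fun l _ => hmi l)
    (ae_of_all _ fun ω => norm_exp_dotA2_sub_le g x j k (j M₁) M₁ M₂ hj t ht ω)

/-- Since l ≥ p, the subtraction is not truncated and the exponents run upward from k; the full
geometric tail bounds the sum independently of q. -/
lemma sum_Ico_pow_shift_le {r : ℝ} (hr0 : 0 ≤ r) (hr1 : r < 1) (k p q : ℕ) :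
    ∑ l ∈ Finset.Ico p q, r ^ (k + l - p) ≤ r ^ k / (1 - r) := by
  rw [Finset.sum_Ico_eq_sum_range]
  have e : ∀ i, r ^ (k + (p + i) - p) = r ^ k * r ^ i := fun i => by
    rw [← pow_add]; congr 1; omega
  simp only [e]
  rw [← Finset.mul_sum, div_eq_mul_inv, ← tsum_geometric_of_lt_one hr0 hr1]
  exact mul_le_mul_of_nonneg_left
    ((summable_geometric_of_lt_one hr0 hr1).sum_le_tsum _ fun i _ => pow_nonneg hr0 i)
    (pow_nonneg hr0 k)

end Decoupling

end PosMatrix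

/-! ### The decorrelation estimate -/

theorem proposition5p1 {Ω : Type*} [MeasurableSpace Ω] (P : Measure Ω) [IsProbabilityMeasure P]
    (d : ℕ) (μ : Measure (PosMatrix.Mat d)) [IsProbabilityMeasure μ]
    (hμS : ∀ᵐ h ∂μ, h ∈ PosMatrix.semigroupS d)
    (g : ℕ → Ω → PosMatrix.Mat d)
    (hmeas : ∀ n, Measurable (g n))
    (hindep : iIndepFun g P)
    (hlaw : ∀ n, P.map (g n) = μ)
    (hP1 : PosMatrix.P1 μ) (hP2 : PosMatrix.P2 μ) (hP3 : PosMatrix.P3 μ)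
    (hP4 : PosMatrix.P4 μ) (hP5 : PosMatrix.P5 μ) :
    ∃ ε₀ lam₀ lam₁ lam₂ : ℝ, 0 < ε₀ ∧ ε₀ ≤ 1 ∧ 0 < lam₀ ∧ 0 < lam₁ ∧ 0 < lam₂ ∧
      ∀ x ∈ PosMatrix.simplex d, ∀ (kgap M₁ M₂ : ℕ) (j : ℕ → ℕ),
        StrictMonoOn j (Set.Iic (M₁ + M₂)) →
        ∀ (s : Fin M₁ → ℝ) (t : Fin M₂ → ℝ), ‖(s, t)‖ ≤ ε₀ →
          ‖PosMatrix.phi P g x j kgap s t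
              - PosMatrix.phi1 P g x j s * PosMatrix.phi2 P g x j kgap M₁ t‖
            ≤ lam₀ * Real.exp (-lam₁ * kgap)
              * (1 + (PosMatrix.maxCard j (M₁ + M₂) : ℝ)) ^ (lam₂ * ((M₁ : ℝ) + (M₂ : ℝ))) := by
  obtain ⟨C, r, hC, hr0, hr1, hdecay⟩ :=
    PosMatrix.exists_integral_min_two_abs_incr_sub_le hμS hmeas hindep hlaw hP3
  have h1r : 0 < 1 - r := by linarith
  -- The choice ε₀ = 1 gives |t_m| ≤ 1, and λ₁ = −log r turns the exponential into r^k. The bound is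
  -- already uniform in the blocks and the polynomial factor is at least 1, so any positive λ₂ would
  -- do.
  refine ⟨1, 2 * (C / (1 - r)), -Real.log r, 1, one_pos, le_rfl, by positivity,
    neg_pos.2 (Real.log_neg hr0 hr1), one_pos, fun x hx k M₁ M₂ j hj s t hst => ?_⟩
  have ht : ∀ m, |t m| ≤ 1 := fun m =>
    ((norm_le_pi_norm t m).trans (norm_snd_le (s, t))).trans hst
  have hexp : Real.exp (- -Real.log r * k) = r ^ k := by
    rw [neg_neg, mul_comm, Real.exp_nat_mul, Real.exp_log hr0]
  have hone : (1 : ℝ) ≤ (1 + (PosMatrix.maxCard j (M₁ + M₂) : ℝ)) ^ (1 * ((M₁ : ℝ) + (M₂ : ℝ))) :=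
    Real.one_le_rpow (by simp) (by positivity)
  have hsum : ∑ l ∈ Finset.Ico (j M₁) (j (M₁ + M₂)),
      ∫ ω, min 2 |PosMatrix.incr g x (k + l) ω
        - PosMatrix.incr (fun i => g (j M₁ + i)) x (k + l - j M₁) ω| ∂P
      ≤ C * (r ^ k / (1 - r)) := by
    refine le_trans ?_ (mul_le_mul_of_nonneg_left
      (PosMatrix.sum_Ico_pow_shift_le hr0.le hr1 k (j M₁) (j (M₁ + M₂))) hC.le)
    rw [Finset.mul_sum]
    refine Finset.sum_le_sum fun l hl => ?_
    have hl' := (Finset.mem_Ico.1 hl).1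
    have := hdecay x hx (j M₁) (k + l - j M₁)
    rwa [show j M₁ + (k + l - j M₁) = k + l by omega] at this
  calc _ ≤ 2 * (C * (r ^ k / (1 - r))) := (PosMatrix.norm_phi_sub_le hmeas hindep x j k M₁ M₂ hj
        s t ht).trans (mul_le_mul_of_nonneg_left hsum zero_le_two)
    _ = 2 * (C / (1 - r)) * r ^ k := by ring
    _ ≤ _ := by
      rw [hexp]
      exact le_mul_of_one_le_right (by positivity) hone
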